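/- Let $s\ge 2$ be a fixed integer, let $\alpha>0$, and let $X_1,X_2,\dots$ be independent random variables with the Log-Logistic$(\alpha;0,1)$ distribution, i.e. with distribution function $F(x)=\frac{1}{1+x^{-\alpha}}$ for $x>0$ and $F(x)=0$ for $x\le 0$. For every integer $i\ge 1$ put $n=i(s+1)-1$, let $X_{(1,n)}\le\dots\le X_{(n,n)}$ be the order statistics of $X_1,\dots,X_n$, let $H_m=\sum_{k=1}^m \frac1k$ (with $H_0=0$), and define $$Q^{LL}_{i,s}=\frac{\log\left(X_{(is,n)}/X_{(i,n)}\right)}{2\,(H_{is-1}-H_{i-1})},\qquad Q^{LL*}_{i,s}=\frac{\log\left(X_{(is,n)}/X_{(i,n)}\right)}{2\log s}.$$ Then: i) for all $i\ge 1$, $Q^{LL}_{i,s}$ is integrable and $\mathbb{E}[Q^{LL}_{i,s}]=\frac1\alpha$; ii) $Q^{LL}_{i,s}\to\frac1\alpha$ almost surely as $i\to\infty$; iii) for all $i\ge 1$, $Q^{LL*}_{i,s}$ is integrable and $\mathbb{E}[Q^{LL*}_{i,s}]=\frac{H_{is-1}-H_{i-1}}{\alpha\log s}$, which tends to $\frac1\alpha$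 as $i\to\infty$; iv) $Q^{LL*}_{i,s}\to\frac1\alpha$ almost surely as $i\to\infty$; v) $2\sqrt{i(s+1)-1}\,(H_{is-1}-H_{i-1})\left[\alpha Q^{LL}_{i,s}-\frac{\log s}{H_{is-1}-H_{i-1}}\right]$ converges in distribution, as $i\to\infty$, to the normal law with mean $0$ and variance $\frac{2(s+1)^2(s-1)}{s^2}$; vi) $\sqrt{i(s+1)-1}\left[\alpha Q^{LL*}_{i,s}-1\right]$ converges in distribution, as $i\to\infty$, to the normal law with mean $0$ and variance $\frac{(s+1)^2(s-1)}{2s^2(\log s)^2}$. -/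

import Mathlib

open MeasureTheory ProbabilityTheory Filter Topology

noncomputable section

/-- The cumulative distribution function of the Log-Logistic law with shape `α`,
location `0` and scale `1`. -/
def logLogisticCDF (α x : ℝ) : ℝ :=
  if 0 < x then 1 / (1 + x ^ (-α)) else 0

/-- `ν` is the Log-Logistic law with shape `α`, location `0` and scale `1`. -/
def IsLogLogistic (α : ℝ) (ν : Measure ℝ) : Prop :=
  IsProbabilityMeasure ν ∧ ∀ x : ℝ, cdf ν x = logLogisticCDF α x

/-- The `k`-th order statistic `x_(k,n)` of the sample `x` of size `n`, with `k = 1, …, n`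
(so `x_(1,n)` is the minimum). Outside this range of `k` the value is `0`. -/
def orderStat {n : ℕ} (x : Fin n → ℝ) (k : ℕ) : ℝ :=
  if h : 1 ≤ k ∧ k ≤ n then x (Tuple.sort x ⟨k - 1, by omega⟩) else 0

/-- The sample size `n = i (s + 1) - 1`. -/
abbrev sampleSize (i s : ℕ) : ℕ := i * (s + 1) - 1

/-- `H_{is-1} - H_{i-1}`, a difference of harmonic numbers. -/
def harmonicDiff (i s : ℕ) : ℝ :=
  (harmonic (i * s - 1) : ℝ) - (harmonic (i - 1) : ℝ)

/-- `log (X_(is,n) / X_(i,n))`. -/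
def logRatio (i s : ℕ) (x : Fin (sampleSize i s) → ℝ) : ℝ :=
  Real.log (orderStat x (i * s) / orderStat x i)

/-- The estimator `Q_{i,s}`. -/
def estQ (i s : ℕ) (x : Fin (sampleSize i s) → ℝ) : ℝ :=
  logRatio i s x / harmonicDiff i s

/-- The estimator `Q*_{i,s}`. -/
def estQStar (i s : ℕ) (x : Fin (sampleSize i s) → ℝ) : ℝ :=
  logRatio i s x / Real.log s

/-- The estimator `Q^{LL}_{i,s}`. -/
def estQLL (i s : ℕ) (x : Fin (sampleSize i s) → ℝ) : ℝ :=
  estQ i s x / 2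

/-- The estimator `Q^{LL*}_{i,s}`. -/
def estQLLStar (i s : ℕ) (x : Fin (sampleSize i s) → ℝ) : ℝ :=
  estQStar i s x / 2

end

/-! If `X` is Log-Logistic, then `Y = α log X` is standard logistic: its distribution function is
the sigmoid `σ`. Increasing maps commute with order statistics, so `α log (X_(is) / X_(i)) = Y_(is)
- Y_(i)` and everything reduces to a logistic spacing (`mul_logRatio`).

Mean: `Y_(l) - Y_(k)` is the length of the set of `t` for which the number of observations `≤ t`
lies in `[k, l)`. Fubini, the binomial law of that number and a Beta integral give the sum of `1/r +
1/(n - r)` over `k ≤ r < l` (`lintegral_orderStat_sub`). Since `n + 1 = i + is`, reflecting `r` to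
`n - r` turns this into `2 (H_{is-1} - H_{i-1})`.

Limits: the ranks `i` and `is` sit at levels tending to `1/(s+1) = σ(-log s)` and `s/(s+1) = σ(log
s)`, so the spacing tends to `2 log s`. The Bahadur representation (`tendsto_bahadur`, through
Ghosh's lemma) linearises both quantiles. The logistic density is `f = s/(s+1)²` at both, so the
fluctuation is that of a sum of i.i.d. copies of `-f⁻¹ 1{-log s < Y ≤ log s}`, to which the central
limit theorem applies. -/

/-- The number of the first `n` terms of `y` that are at most `t`. -/
noncomputable def countLE (y : ℕ → ℝ) (n : ℕ) (t : ℝ) : ℕ :=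
  ((Finset.range n).filter (fun j => y j ≤ t)).card

lemma countLE_eq_card_fin (y : ℕ → ℝ) (n : ℕ) (t : ℝ) :
    countLE y n t = (Finset.univ.filter (fun j : Fin n => y j ≤ t)).card := by
  rw [countLE, Finset.card_filter, Finset.card_filter, Finset.sum_range]

/-- Sorting is a permutation, so it preserves the count. Every later argument sees order statistics
only through this equivalence. -/
lemma orderStat_le_iff (y : ℕ → ℝ) {n k : ℕ} (hk : 1 ≤ k) (hkn : k ≤ n) (t : ℝ) :
    orderStat (fun j : Fin n => y j) k ≤ t ↔ k ≤ countLE y n t := by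
  rw [orderStat, dif_pos ⟨hk, hkn⟩, countLE_eq_card_fin]
  set x : Fin n → ℝ := fun j => y j
  have h := Tuple.lt_card_le_iff_apply_le_of_monotone (f := x ∘ Tuple.sort x) (a := t)
    (j := ⟨k - 1, by omega⟩) (Tuple.monotone_sort x)
  have hc : (Finset.univ.filter (fun j : Fin n => (x ∘ Tuple.sort x) j ≤ t)).card =
      (Finset.univ.filter (fun j : Fin n => x j ≤ t)).card := by
    simp only [Finset.card_filter, Function.comp]
    exact Equiv.sum_comp (Tuple.sort x) (fun j => if x j ≤ t then 1 else 0)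
  rw [hc] at h
  simp only [Function.comp] at h
  rw [← h]
  change k - 1 < (Finset.univ.filter (fun j : Fin n => x j ≤ t)).card ↔
    k ≤ (Finset.univ.filter (fun j : Fin n => x j ≤ t)).card
  omega

lemma lt_orderStat_iff (y : ℕ → ℝ) {n k : ℕ} (hk : 1 ≤ k) (hkn : k ≤ n) (t : ℝ) :
    t < orderStat (fun j : Fin n => y j) k ↔ countLE y n t < k := by
  rw [← not_le, orderStat_le_iff y hk hkn, not_le]

lemma orderStat_pos {x : ℕ → ℝ} (hx : ∀ j, 0 < x j) {n k : ℕ} (hk : 1 ≤ k) (hkn : k ≤ n) :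
    0 < orderStat (fun j : Fin n => x j) k := by
  rw [orderStat, dif_pos ⟨hk, hkn⟩]
  exact hx _

lemma mul_log_orderStat {α : ℝ} (hα : 0 < α) {x : ℕ → ℝ} (hx : ∀ j, 0 < x j) {n k : ℕ}
    (hk : 1 ≤ k) (hkn : k ≤ n) :
    α * Real.log (orderStat (fun j : Fin n => x j) k) =
      orderStat (fun j : Fin n => α * Real.log (x j)) k := by
  have key : ∀ z : ℝ, 0 < z → ∀ t, α * Real.log z ≤ t ↔ z ≤ Real.exp (t / α) := by
    intro z hz t
    rw [← Real.log_le_iff_le_exp hz, le_div_iff₀ hα, mul_comm]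
  -- Comparing both sides with every threshold `t` avoids relating the two sorting permutations.
  refine eq_of_forall_ge_iff fun t => ?_
  rw [key _ (orderStat_pos hx hk hkn), orderStat_le_iff x hk hkn,
    orderStat_le_iff (fun j => α * Real.log (x j)) hk hkn]
  simp only [countLE, key _ (hx _)]

lemma orderStat_mono (y : ℕ → ℝ) {n k l : ℕ} (hk : 1 ≤ k) (hkl : k ≤ l) (hl : l ≤ n) :
    orderStat (fun j : Fin n => y j) k ≤ orderStat (fun j : Fin n => y j) l := by
  rw [orderStat_le_iff y hk (hkl.trans hl)]
  exact hkl.trans ((orderStat_le_iff y (hk.trans hkl) hl _).1 le_rfl)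

section Measurability

variable {Ω : Type*} [MeasurableSpace Ω]

lemma measurable_countLE {Y : ℕ → Ω → ℝ} (hY : ∀ j, Measurable (Y j)) (n : ℕ) (t : ℝ) :
    Measurable (fun ω => countLE (fun j => Y j ω) n t) := by
  simp only [countLE, Finset.card_filter]
  refine Finset.measurable_fun_sum _ fun j _ => ?_
  exact Measurable.ite (measurableSet_le (hY j) measurable_const) measurable_const measurable_const

lemma measurable_orderStat {Y : ℕ → Ω → ℝ} (hY : ∀ j, Measurable (Y j)) (n k : ℕ) :
    Measurable (fun ω => orderStat (fun j : Fin n => Y j ω) k) := by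
  by_cases h : 1 ≤ k ∧ k ≤ n
  · refine measurable_of_Iic fun t => ?_
    have : (fun ω => orderStat (fun j : Fin n => Y j ω) k) ⁻¹' Set.Iic t =
        {ω | k ≤ countLE (fun j => Y j ω) n t} := by
      ext ω
      exact orderStat_le_iff (fun j => Y j ω) h.1 h.2 t
    rw [this]
    exact measurableSet_le measurable_const (measurable_countLE hY n t)
  · simp only [orderStat, dif_neg h]
    exact measurable_const

end Measurability

/-! ### Logistic samples: Beta integrals and mean spacings -/

/-- The sequence `Y` is a sample of independent standard logistic variables. -/
structure IsLogisticSample {Ω : Type*} [MeasurableSpace Ω] (μ : Measure Ω) (Y : ℕ → Ω → ℝ) :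
    Prop where
  measurable : ∀ j, Measurable (Y j)
  indep : iIndepFun Y μ
  law : ∀ j t, μ.real {ω | Y j ω ≤ t} = Real.sigmoid t

/-- The integrand is the logistic density `σ'`, so its integral over `[-i, i]` is `σ(i) - σ(-i) ≤
1`. -/
lemma integrable_sigmoid_mul_one_sub :
    Integrable (fun y => Real.sigmoid y * (1 - Real.sigmoid y)) := by
  have hc : Continuous fun y => Real.sigmoid y * (1 - Real.sigmoid y) := by fun_prop
  refine integrable_of_intervalIntegral_norm_bounded (l := atTop) (a := fun i : ℕ => -(i : ℝ))
    (b := fun i : ℕ => (i : ℝ)) 1 (fun i => hc.integrableOn_Ioc)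
    (tendsto_neg_atTop_atBot.comp tendsto_natCast_atTop_atTop) tendsto_natCast_atTop_atTop
    (.of_forall fun i => ?_)
  have h : ∀ y, ‖Real.sigmoid y * (1 - Real.sigmoid y)‖ = Real.sigmoid y * (1 - Real.sigmoid y) :=
    fun y => Real.norm_of_nonneg
      (mul_nonneg (Real.sigmoid_nonneg y) (sub_nonneg.2 (Real.sigmoid_le_one y)))
  simp only [h]
  rw [intervalIntegral.integral_eq_sub_of_hasDerivAt (fun y _ => Real.hasDerivAt_sigmoid y)
    (hc.intervalIntegrable _ _)]
  linarith [Real.sigmoid_le_one i, Real.sigmoid_nonneg (-(i : ℝ))]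

lemma integrable_sigmoid_pow_mul (k m : ℕ) :
    Integrable (fun y => Real.sigmoid y ^ (k + 1) * (1 - Real.sigmoid y) ^ (m + 1)) := by
  refine integrable_sigmoid_mul_one_sub.mono' (by fun_prop) (.of_forall fun y => ?_)
  have h0 := Real.sigmoid_nonneg y
  have h1 : 0 ≤ 1 - Real.sigmoid y := sub_nonneg.2 (Real.sigmoid_le_one y)
  rw [Real.norm_of_nonneg (by positivity)]
  gcongr
  · exact pow_le_of_le_one h0 (Real.sigmoid_le_one y) (by omega)
  · exact pow_le_of_le_one h1 (by linarith) (by omega)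

/-- With `u = σ(y)` this is the Beta integral `B(k+1, m+1)`. The induction on `m` integrates the
derivative of `σ^(k+1) (1-σ)^(m+1)`, whose boundary values vanish. -/
lemma integral_sigmoid_pow_mul (k m : ℕ) :
    ∫ y, Real.sigmoid y ^ (k + 1) * (1 - Real.sigmoid y) ^ (m + 1) =
      (k.factorial * m.factorial : ℝ) / (k + m + 1).factorial := by
  induction m with
  | zero =>
    have hd : ∀ y, HasDerivAt (fun y => Real.sigmoid y ^ (k + 1) / (k + 1))
        (Real.sigmoid y ^ (k + 1) * (1 - Real.sigmoid y) ^ (0 + 1)) y := by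
      intro y
      convert! ((Real.hasDerivAt_sigmoid y).pow (k + 1)).div_const ((k : ℝ) + 1) using 1
      push_cast
      field_simp
      ring
    rw [integral_of_hasDerivAt_of_tendsto hd (integrable_sigmoid_pow_mul k 0)
      ((Real.tendsto_sigmoid_atBot.pow (k + 1)).div_const _)
      ((Real.tendsto_sigmoid_atTop.pow (k + 1)).div_const _)]
    simp [Nat.factorial_succ]
    field_simp
  | succ m ih =>
    have hd : ∀ y, HasDerivAt (fun y => Real.sigmoid y ^ (k + 1) * (1 - Real.sigmoid y) ^ (m + 1))
        ((k + m + 2) * (Real.sigmoid y ^ (k + 1) * (1 - Real.sigmoid y) ^ (m + 1 + 1)) -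
          (m + 1) * (Real.sigmoid y ^ (k + 1) * (1 - Real.sigmoid y) ^ (m + 1))) y := by
      intro y
      convert! ((Real.hasDerivAt_sigmoid y).pow (k + 1)).mul
        (((Real.hasDerivAt_sigmoid y).const_sub 1).pow (m + 1)) using 1
      simp only [Nat.add_sub_cancel]
      push_cast
      simp only [Pi.pow_apply]
      ring
    have h := integral_of_hasDerivAt_of_tendsto hd
      (((integrable_sigmoid_pow_mul k (m + 1)).const_mul _).sub
        ((integrable_sigmoid_pow_mul k m).const_mul _))
      ((Real.tendsto_sigmoid_atBot.pow (k + 1)).mul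
        ((Real.tendsto_sigmoid_atBot.const_sub 1).pow (m + 1)))
      ((Real.tendsto_sigmoid_atTop.pow (k + 1)).mul
        ((Real.tendsto_sigmoid_atTop.const_sub 1).pow (m + 1)))
    rw [integral_sub ((integrable_sigmoid_pow_mul k (m + 1)).const_mul _)
        ((integrable_sigmoid_pow_mul k m).const_mul _), integral_const_mul, integral_const_mul,
      ih] at h
    simp only [ne_eq, Nat.add_eq_zero_iff, one_ne_zero, and_false, not_false_eq_true, zero_pow,
      zero_mul, sub_self, mul_zero] at h
    have hf : ((k + (m + 1) + 1).factorial : ℝ) = (k + m + 2) * (k + m + 1).factorial := by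
      rw [show k + (m + 1) + 1 = (k + m + 1) + 1 by ring, Nat.factorial_succ]
      push_cast; ring
    have h0 : ((k + m + 1).factorial : ℝ) ≠ 0 := by positivity
    have h2 : (k + m + 2 : ℝ) ≠ 0 := by positivity
    rw [hf, Nat.factorial_succ m]
    push_cast
    field_simp at h ⊢
    linarith

namespace IsLogisticSample

variable {Ω : Type*} [MeasurableSpace Ω] {μ : Measure Ω} [IsProbabilityMeasure μ]
  {Y : ℕ → Ω → ℝ}

lemma measureReal_countLE_eq (h : IsLogisticSample μ Y) (n k : ℕ) (t : ℝ) :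
    μ.real {ω | countLE (fun j => Y j ω) n t = k} =
      n.choose k * Real.sigmoid t ^ k * (1 - Real.sigmoid t) ^ (n - k) := by
  classical
  -- The event is split according to the exact set `S` of indices with `Y j ≤ t`; independence gives
  -- each piece the same probability.
  set A : Finset ℕ → Set Ω := fun S => {ω | (Finset.range n).filter (fun j => Y j ω ≤ t) = S}
  have hA : ∀ S ⊆ Finset.range n, A S = ⋂ j ∈ Finset.range n,
      Y j ⁻¹' (if j ∈ S then Set.Iic t else Set.Ioi t) := by
    intro S hS
    ext ω
    simp only [A, Set.mem_ofPred_eq, Set.mem_iInter, Finset.ext_iff, Finset.mem_filter,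
      Set.mem_preimage]
    refine forall_congr' fun j => ?_
    by_cases hj : j ∈ S
    · simp [hj, hS hj]
    · simp [hj]
  have hm : ∀ S : Finset ℕ, ∀ j,
      MeasurableSet (if j ∈ S then Set.Iic t else Set.Ioi t) := by
    intro S j
    split_ifs
    exacts [measurableSet_Iic, measurableSet_Ioi]
  have hAm : ∀ S ⊆ Finset.range n, MeasurableSet (A S) := by
    intro S hS
    rw [hA S hS]
    exact Finset.measurableSet_biInter _ fun j _ => h.measurable j (hm S j)
  have hAμ : ∀ S ∈ (Finset.range n).powersetCard k,
      μ.real (A S) = Real.sigmoid t ^ k * (1 - Real.sigmoid t) ^ (n - k) := by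
    intro S hS
    obtain ⟨hS, hk⟩ := Finset.mem_powersetCard.1 hS
    rw [hA S hS, measureReal_def, h.indep.measure_inter_preimage_eq_mul _ (fun j _ => hm S j),
      ENNReal.toReal_prod]
    have : ∀ j ∈ Finset.range n, (μ (Y j ⁻¹' (if j ∈ S then Set.Iic t else Set.Ioi t))).toReal =
        if j ∈ S then Real.sigmoid t else 1 - Real.sigmoid t := by
      intro j _
      split_ifs
      · exact h.law j t
      · rw [← h.law j t, ← probReal_compl_eq_one_sub (measurableSet_le (h.measurable j)
          measurable_const), measureReal_def]
        congr 2
        ext ω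
        simp
    rw [Finset.prod_congr rfl this, Finset.prod_ite, Finset.prod_const, Finset.prod_const,
      Finset.filter_mem_eq_inter, Finset.inter_eq_right.2 hS, hk, ← Finset.sdiff_eq_filter,
      Finset.card_sdiff_of_subset hS, hk, Finset.card_range]
  have hU : {ω | countLE (fun j => Y j ω) n t = k} =
      ⋃ S ∈ (Finset.range n).powersetCard k, A S := by
    ext ω
    simp [A, countLE, Finset.mem_powersetCard]
  rw [hU, measureReal_biUnion_finset, Finset.sum_congr rfl hAμ, Finset.sum_const,
    Finset.card_powersetCard, Finset.card_range, nsmul_eq_mul, mul_assoc]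
  · intro S _ T _ hST
    refine Set.disjoint_left.2 fun ω hS hT => hST ?_
    exact hS.symm.trans hT
  · intro S hS
    exact hAm S (Finset.mem_powersetCard.1 hS).1

lemma lintegral_orderStat_sub (h : IsLogisticSample μ Y) {n k l : ℕ} (hk : 1 ≤ k) (hkl : k ≤ l)
    (hl : l ≤ n) :
    ∫⁻ ω, ENNReal.ofReal (orderStat (fun j : Fin n => Y j ω) l -
      orderStat (fun j : Fin n => Y j ω) k) ∂μ =
      ENNReal.ofReal (∑ r ∈ Finset.Ico k l, (1 / (r : ℝ) + 1 / ((n - r : ℕ) : ℝ))) := by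
  set U : Ω → ℝ := fun ω => orderStat (fun j : Fin n => Y j ω) k with hUdef
  set V : Ω → ℝ := fun ω => orderStat (fun j : Fin n => Y j ω) l with hVdef
  have hU : Measurable U := measurable_orderStat h.measurable n k
  have hV : Measurable V := measurable_orderStat h.measurable n l
  -- The measure of the region between the two order statistics is computed by slicing in `ω` and
  -- then in `t`. Working with `lintegral` makes integrability a consequence.
  set B : Set (Ω × ℝ) := {p | U p.1 ≤ p.2 ∧ p.2 < V p.1} with hB
  have hBm : MeasurableSet B :=
    (measurableSet_le (hU.comp measurable_fst) measurable_snd).inter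
      (measurableSet_lt measurable_snd (hV.comp measurable_fst))
  have h1 : (μ.prod volume) B = ∫⁻ ω, ENNReal.ofReal (V ω - U ω) ∂μ := by
    rw [Measure.prod_apply hBm]
    refine lintegral_congr fun ω => ?_
    rw [← Real.volume_Ico]
    rfl
  have h2 : (μ.prod volume) B = ∫⁻ t, μ ((fun ω => (ω, t)) ⁻¹' B) := Measure.prod_apply_symm hBm
  have h3 : ∀ t, μ ((fun ω => (ω, t)) ⁻¹' B) = ENNReal.ofReal (∑ r ∈ Finset.Ico k l,
      n.choose r * (Real.sigmoid t ^ r * (1 - Real.sigmoid t) ^ (n - r))) := by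
    intro t
    have : (fun ω => (ω, t)) ⁻¹' B =
        ⋃ r ∈ Finset.Ico k l, {ω | countLE (fun j => Y j ω) n t = r} := by
      ext ω
      simp only [hB, hUdef, hVdef, Set.mem_preimage, Set.mem_ofPred_eq,
        orderStat_le_iff (fun j => Y j ω) hk (hkl.trans hl),
        lt_orderStat_iff (fun j => Y j ω) (hk.trans hkl) hl, Set.mem_iUnion, Finset.mem_Ico,
        exists_prop, exists_eq_right']
    rw [this, ← ofReal_measureReal (measure_ne_top μ _), measureReal_biUnion_finset]
    · simp only [h.measureReal_countLE_eq, mul_assoc]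
    · intro S _ T _ hST
      refine Set.disjoint_left.2 fun ω hS hT => hST ?_
      exact hS.symm.trans hT
    · intro r _
      exact measurable_countLE h.measurable n t (measurableSet_singleton r)
  have hterm : ∀ r ∈ Finset.Ico k l,
      Integrable (fun t => (n.choose r : ℝ) *
        (Real.sigmoid t ^ r * (1 - Real.sigmoid t) ^ (n - r))) ∧
      ∫ t, (n.choose r : ℝ) * (Real.sigmoid t ^ r * (1 - Real.sigmoid t) ^ (n - r)) =
        1 / (r : ℝ) + 1 / ((n - r : ℕ) : ℝ) := by
    intro r hr
    rw [Finset.mem_Ico] at hr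
    -- Here `1 ≤ r < n`, so both exponents are positive, as the Beta integral requires.
    obtain ⟨a, rfl⟩ : ∃ a, r = a + 1 := ⟨r - 1, by omega⟩
    obtain ⟨b, rfl⟩ : ∃ b, n = a + 1 + (b + 1) := ⟨n - (a + 1) - 1, by omega⟩
    rw [Nat.add_sub_cancel_left]
    refine ⟨(integrable_sigmoid_pow_mul a b).const_mul _, ?_⟩
    rw [integral_const_mul, integral_sigmoid_pow_mul, Nat.cast_add_choose,
      show a + 1 + (b + 1) = (a + b + 1) + 1 by ring, Nat.factorial_succ (a + b + 1),
      Nat.factorial_succ a, Nat.factorial_succ b]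
    have h1 := Nat.factorial_pos a
    have h2 := Nat.factorial_pos b
    have h3 := Nat.factorial_pos (a + b + 1)
    push_cast
    field_simp
    ring
  rw [← h1, h2, lintegral_congr h3, ← ofReal_integral_eq_lintegral_ofReal,
    integral_finsetSum _ fun r hr => (hterm r hr).1,
    Finset.sum_congr rfl fun r hr => (hterm r hr).2]
  · exact integrable_finsetSum _ fun r hr => (hterm r hr).1
  · refine .of_forall fun t => Finset.sum_nonneg fun r _ => ?_
    have h0 := Real.sigmoid_nonneg t
    have h1 : 0 ≤ 1 - Real.sigmoid t := sub_nonneg.2 (Real.sigmoid_le_one t)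
    positivity

lemma integrable_orderStat_sub (h : IsLogisticSample μ Y) {n k l : ℕ} (hk : 1 ≤ k) (hkl : k ≤ l)
    (hl : l ≤ n) :
    Integrable (fun ω => orderStat (fun j : Fin n => Y j ω) l -
      orderStat (fun j : Fin n => Y j ω) k) μ := by
  refine ⟨((measurable_orderStat h.measurable n l).sub
    (measurable_orderStat h.measurable n k)).aestronglyMeasurable, ?_⟩
  rw [hasFiniteIntegral_iff_ofReal (.of_forall fun ω =>
    sub_nonneg.2 (orderStat_mono (fun j => Y j ω) hk hkl hl)), h.lintegral_orderStat_sub hk hkl hl]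
  exact ENNReal.ofReal_lt_top

lemma integral_orderStat_sub (h : IsLogisticSample μ Y) {n k l : ℕ} (hk : 1 ≤ k) (hkl : k ≤ l)
    (hl : l ≤ n) :
    ∫ ω, (orderStat (fun j : Fin n => Y j ω) l - orderStat (fun j : Fin n => Y j ω) k) ∂μ =
      ∑ r ∈ Finset.Ico k l, (1 / (r : ℝ) + 1 / ((n - r : ℕ) : ℝ)) := by
  rw [integral_eq_lintegral_of_nonneg_ae (.of_forall fun ω =>
    sub_nonneg.2 (orderStat_mono (fun j => Y j ω) hk hkl hl))
    (h.integrable_orderStat_sub hk hkl hl).aestronglyMeasurable,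
    h.lintegral_orderStat_sub hk hkl hl, ENNReal.toReal_ofReal]
  exact Finset.sum_nonneg fun r _ => by positivity

end IsLogisticSample

/-! ### Harmonic differences -/

lemma harmonicDiff_eq_sum {i s : ℕ} (hi : 1 ≤ i) (hs : 1 ≤ s) :
    harmonicDiff i s = ∑ r ∈ Finset.Ico i (i * s), 1 / (r : ℝ) := by
  have hH : ∀ m : ℕ, 1 ≤ m → (harmonic (m - 1) : ℝ) = ∑ r ∈ Finset.Ico 1 m, 1 / (r : ℝ) := by
    intro m hm
    rw [harmonic_eq_sum_Icc, show Finset.Icc 1 (m - 1) = Finset.Ico 1 m by ext; simp; omega]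
    simp
  have his : i ≤ i * s := Nat.le_mul_of_pos_right i hs
  rw [harmonicDiff, hH _ hi, hH _ (hi.trans his),
    ← Finset.sum_Ico_consecutive (fun r : ℕ => 1 / (r : ℝ)) hi his, add_sub_cancel_left]

lemma sum_inv_add_inv_eq_harmonicDiff {i s : ℕ} (hi : 1 ≤ i) (hs : 1 ≤ s) :
    ∑ r ∈ Finset.Ico i (i * s), (1 / (r : ℝ) + 1 / ((sampleSize i s - r : ℕ) : ℝ)) =
      2 * harmonicDiff i s := by
  have his : i ≤ i * s := Nat.le_mul_of_pos_right i hs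
  have hn : sampleSize i s + 1 = i + i * s := by
    have : 1 ≤ i * (s + 1) := Nat.mul_pos hi (Nat.succ_pos s)
    rw [sampleSize, Nat.sub_add_cancel this]; ring
  rw [Finset.sum_add_distrib, two_mul, harmonicDiff_eq_sum hi hs]
  congr 1
  -- Because `n + 1 = i + is`, the reflection `r ↦ n - r` is an involution of `[i, is)`.
  refine Finset.sum_bij' (fun r _ => sampleSize i s - r)
    (fun r _ => sampleSize i s - r) ?_ ?_ ?_ ?_ ?_
    <;> intro r hr <;> rw [Finset.mem_Ico] at hr
  · rw [Finset.mem_Ico]; omega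
  · rw [Finset.mem_Ico]; omega
  · omega
  · omega

lemma harmonicDiff_pos {i s : ℕ} (hi : 1 ≤ i) (hs : 2 ≤ s) : 0 < harmonicDiff i s := by
  rw [harmonicDiff_eq_sum hi (by omega)]
  refine Finset.sum_pos (fun r hr => ?_) ⟨i, ?_⟩
  · have : 0 < r := by rw [Finset.mem_Ico] at hr; omega
    positivity
  · rw [Finset.mem_Ico]
    exact ⟨le_rfl, by nlinarith⟩

/-- The Euler–Mascheroni constants of the two harmonic numbers cancel, leaving the logarithm of `(is
- 1)/(i - 1) = s + (s - 1)/(i - 1)`. -/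
lemma tendsto_harmonicDiff {s : ℕ} (hs : 2 ≤ s) :
    Tendsto (fun i => harmonicDiff i s) atTop (𝓝 (Real.log s)) := by
  have hpred : ∀ c : ℕ, 1 ≤ c → Tendsto (fun i : ℕ => i * c - 1) atTop atTop := by
    intro c hc
    refine tendsto_atTop_mono (f := fun i => i - 1) (fun i => ?_) (tendsto_sub_atTop_nat 1)
    exact Nat.sub_le_sub_right (Nat.le_mul_of_pos_right i hc) 1
  have h1 := (Real.tendsto_harmonic_sub_log.comp (hpred s (by omega))).sub
    (Real.tendsto_harmonic_sub_log.comp (hpred 1 le_rfl))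
  have hr : Tendsto (fun i : ℕ => ((i * s - 1 : ℕ) : ℝ) / ((i * 1 - 1 : ℕ) : ℝ)) atTop (𝓝 s) := by
    have h2 : Tendsto (fun i : ℕ => (s : ℝ) + (s - 1) / ((i * 1 - 1 : ℕ) : ℝ)) atTop
        (𝓝 ((s : ℝ) + 0)) :=
      (tendsto_const_nhds.div_atTop (tendsto_natCast_atTop_atTop.comp (hpred 1 le_rfl))).const_add _
    rw [add_zero] at h2
    refine h2.congr' ?_
    filter_upwards [eventually_ge_atTop 2] with i hi
    have h3 : (i : ℝ) - 1 ≠ 0 := by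
      have : (2 : ℝ) ≤ i := by exact_mod_cast hi
      linarith
    rw [Nat.cast_sub (by omega), Nat.cast_sub (by nlinarith)]
    push_cast
    rw [mul_one]
    field_simp
    ring
  have h4 := h1.add ((Real.continuousAt_log (x := (s : ℝ)) (by positivity)).tendsto.comp hr)
  rw [sub_self, zero_add] at h4
  refine h4.congr' ?_
  filter_upwards [eventually_ge_atTop 2] with i hi
  have ha : ((i * s - 1 : ℕ) : ℝ) ≠ 0 := by
    have : 1 < i * s := by nlinarith
    exact_mod_cast (Nat.sub_pos_of_lt this).ne'
  have hb : ((i * 1 - 1 : ℕ) : ℝ) ≠ 0 := by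
    exact_mod_cast (Nat.sub_pos_of_lt (show 1 < i * 1 by omega)).ne'
  rw [mul_one] at hb
  simp only [Function.comp, harmonicDiff, mul_one, Real.log_div ha hb]
  ring

/-! ### Empirical distribution function and strong consistency of quantiles -/

/-- The indicator function of `(-∞, t]`. -/
noncomputable def indLE (t y : ℝ) : ℝ := if y ≤ t then 1 else 0

lemma measurable_indLE (t : ℝ) : Measurable (indLE t) :=
  Measurable.ite measurableSet_Iic measurable_const measurable_const

lemma abs_indLE_le (t y : ℝ) : |indLE t y| ≤ 1 := by
  unfold indLE; split_ifs <;> simp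

lemma abs_indLE_sub_le (a b y : ℝ) : |indLE b y - indLE a y| ≤ 1 := by
  unfold indLE; split_ifs <;> simp

/-- The difference is, up to sign, the indicator of the interval between `a` and `b`; this yields
second moments of increments. -/
lemma indLE_sub_sq (a b y : ℝ) :
    (indLE b y - indLE a y) ^ 2 = indLE (max a b) y - indLE (min a b) y := by
  unfold indLE
  rcases le_total a b with h | h
  · rw [max_eq_right h, min_eq_left h]
    split_ifs <;> first | (exfalso; linarith) | norm_num
  · rw [max_eq_left h, min_eq_right h]
    split_ifs <;> first | (exfalso; linarith) | norm_num

lemma countLE_eq_sum_indLE (y : ℕ → ℝ) (n : ℕ) (t : ℝ) :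
    (countLE y n t : ℝ) = ∑ j ∈ Finset.range n, indLE t (y j) := by
  rw [countLE, Finset.card_filter]
  push_cast
  rfl

namespace IsLogisticSample

variable {Ω : Type*} [MeasurableSpace Ω] {μ : Measure Ω} [IsProbabilityMeasure μ]
  {Y : ℕ → Ω → ℝ}

lemma identDistrib (h : IsLogisticSample μ Y) (j : ℕ) : IdentDistrib (Y j) (Y 0) μ μ := by
  refine ⟨(h.measurable j).aemeasurable, (h.measurable 0).aemeasurable, ?_⟩
  have hp : ∀ j, IsProbabilityMeasure (μ.map (Y j)) := fun j =>
    Measure.isProbabilityMeasure_map (h.measurable j).aemeasurable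
  have := hp j
  have := hp 0
  refine Measure.eq_of_cdf _ _ ?_
  ext t
  rw [cdf_eq_real, cdf_eq_real, map_measureReal_apply (h.measurable j) measurableSet_Iic,
    map_measureReal_apply (h.measurable 0) measurableSet_Iic]
  exact (h.law j t).trans (h.law 0 t).symm

lemma memLp_comp (h : IsLogisticSample μ Y) {φ : ℝ → ℝ} (hφ : Measurable φ) {c : ℝ}
    (hc : ∀ y, |φ y| ≤ c) (j : ℕ) (p : ENNReal) : MemLp (fun ω => φ (Y j ω)) p μ :=
  MemLp.of_bound (hφ.comp (h.measurable j)).aestronglyMeasurable c (.of_forall fun _ => hc _)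

lemma integrable_indLE (h : IsLogisticSample μ Y) (j : ℕ) (t : ℝ) :
    Integrable (fun ω => indLE t (Y j ω)) μ :=
  memLp_one_iff_integrable.1 (h.memLp_comp (measurable_indLE t) (abs_indLE_le t) j 1)

omit [IsProbabilityMeasure μ] in
lemma integral_indLE (h : IsLogisticSample μ Y) (j : ℕ) (t : ℝ) :
    ∫ ω, indLE t (Y j ω) ∂μ = Real.sigmoid t := by
  have : (fun ω => indLE t (Y j ω)) = {ω | Y j ω ≤ t}.indicator 1 := by
    ext ω
    simp [indLE, Set.indicator_apply]
  rw [this, integral_indicator_one (measurableSet_le (h.measurable j) measurable_const), h.law]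

lemma ae_tendsto_countLE_div (h : IsLogisticSample μ Y) (t : ℝ) :
    ∀ᵐ ω ∂μ, Tendsto (fun n : ℕ => (countLE (fun j => Y j ω) n t : ℝ) / n) atTop
      (𝓝 (Real.sigmoid t)) := by
  have := strong_law_ae_real (fun j ω => indLE t (Y j ω)) (h.integrable_indLE 0 t)
    (fun a b hab => (h.indep.indepFun hab).comp (measurable_indLE t) (measurable_indLE t))
    (fun j => (h.identDistrib j).comp (measurable_indLE t))
  simpa only [countLE_eq_sum_indLE, h.integral_indLE] using this

/-- Strong consistency of sample quantiles. -/
lemma ae_tendsto_orderStat (h : IsLogisticSample μ Y) {n k : ℕ → ℕ} {ξ : ℝ}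
    (hn : Tendsto n atTop atTop) (hk : ∀ᶠ i in atTop, 1 ≤ k i ∧ k i ≤ n i)
    (hkn : Tendsto (fun i => (k i : ℝ) / n i) atTop (𝓝 (Real.sigmoid ξ))) :
    ∀ᵐ ω ∂μ, Tendsto (fun i => orderStat (fun j : Fin (n i) => Y j ω) (k i)) atTop (𝓝 ξ) := by
  -- Rational thresholds need only countably many null sets, and they separate `ξ` from any other
  -- real.
  have hae : ∀ᵐ ω ∂μ, ∀ t : ℚ, Tendsto
      (fun n : ℕ => (countLE (fun j => Y j ω) n t : ℝ) / n) atTop (𝓝 (Real.sigmoid t)) :=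
    ae_all_iff.2 fun t => h.ae_tendsto_countLE_div t
  filter_upwards [hae] with ω hω
  refine tendsto_order.2 ⟨fun a ha => ?_, fun b hb => ?_⟩
  · obtain ⟨t, hat, htξ⟩ := exists_rat_btwn ha
    filter_upwards [hk, ((hω t).comp hn).eventually_lt hkn (Real.sigmoid_lt htξ)] with i hi hlt
    have hpos : (0 : ℝ) < n i := by exact_mod_cast (by omega : 0 < n i)
    refine hat.trans ((lt_orderStat_iff (fun j => Y j ω) hi.1 hi.2 _).2 ?_)
    exact_mod_cast (div_lt_div_iff_of_pos_right hpos).1 hlt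
  · obtain ⟨t, hξt, htb⟩ := exists_rat_btwn hb
    filter_upwards [hk, hkn.eventually_lt ((hω t).comp hn) (Real.sigmoid_lt hξt)] with i hi hlt
    have hpos : (0 : ℝ) < n i := by exact_mod_cast (by omega : 0 < n i)
    refine ((orderStat_le_iff (fun j => Y j ω) hi.1 hi.2 _).2 ?_).trans_lt htb
    exact_mod_cast ((div_lt_div_iff_of_pos_right hpos).1 hlt).le

/-- Chebyshev's inequality, with the variance bounded by the second moment. -/
lemma measureReal_abs_sum_sub_ge_le (h : IsLogisticSample μ Y) {φ : ℝ → ℝ} (hφ : Measurable φ)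
    (hb : ∀ y, |φ y| ≤ 1) (n : ℕ) {c : ℝ} (hc : 0 < c) :
    μ.real {ω | c ≤ |∑ j ∈ Finset.range n, φ (Y j ω) - n * ∫ ω, φ (Y 0 ω) ∂μ|} ≤
      n * (∫ ω, φ (Y 0 ω) ^ 2 ∂μ) / c ^ 2 := by
  have hL : ∀ j, MemLp (fun ω => φ (Y j ω)) 2 μ := fun j => h.memLp_comp hφ hb j 2
  have hid : ∀ j, IdentDistrib (fun ω => φ (Y j ω)) (fun ω => φ (Y 0 ω)) μ μ :=
    fun j => (h.identDistrib j).comp hφ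
  set S : Ω → ℝ := ∑ j ∈ Finset.range n, fun ω => φ (Y j ω) with hS
  have hmean : ∫ ω, S ω ∂μ = n * ∫ ω, φ (Y 0 ω) ∂μ := by
    simp only [hS, Finset.sum_apply]
    rw [integral_finsetSum _ fun j _ => (hL j).integrable (by norm_num)]
    simp [fun j => (hid j).integral_eq]
  have hvar : variance S μ = n * variance (fun ω => φ (Y 0 ω)) μ := by
    rw [hS, IndepFun.variance_sum (fun j _ => hL j)
      (fun a _ b _ hab => (h.indep.indepFun hab).comp hφ hφ)]
    simp [fun j => (hid j).variance_eq]
  have hch := meas_ge_le_variance_div_sq (memLp_finsetSum' (Finset.range n) fun j _ => hL j) hc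
  rw [← hS, hmean, hvar] at hch
  have h1 := ENNReal.toReal_mono ENNReal.ofReal_ne_top hch
  rw [ENNReal.toReal_ofReal (by have := variance_nonneg (fun ω => φ (Y 0 ω)) μ; positivity)] at h1
  have hv := variance_le_expectation_sq (μ := μ) (hL 0).aestronglyMeasurable
  simp only [hS, Finset.sum_apply] at h1
  refine h1.trans ?_
  gcongr
  exact hv

end IsLogisticSample

/-! ### Ghosh's lemma and the Bahadur representation -/

/-- A form of Ghosh's lemma: if `V i ≤ t` is the event `Z t i ≤ τ t i` with `τ t i → t`, and
`Z t i - W i → 0` in probability for every `t`, then `V - W → 0` in probability, provided `W` is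
tight. -/
lemma tendstoInMeasure_sub_of_le_iff {Ω : Type*} [MeasurableSpace Ω] {μ : Measure Ω}
    [IsProbabilityMeasure μ] {V W : ℕ → Ω → ℝ} {Z : ℝ → ℕ → Ω → ℝ} {τ : ℝ → ℕ → ℝ}
    (hτ : ∀ t, Tendsto (τ t) atTop (𝓝 t))
    (hZ : ∀ t, ∀ δ > 0, Tendsto (fun i => μ.real {ω | δ ≤ |Z t i ω - W i ω|}) atTop (𝓝 0))
    (hV : ∀ t, ∀ᶠ i in atTop, ∀ ω, V i ω ≤ t ↔ Z t i ω ≤ τ t i)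
    (hW : ∀ η > 0, ∃ M, ∀ᶠ i in atTop, μ.real {ω | M ≤ |W i ω|} ≤ η) :
    ∀ ε > 0, Tendsto (fun i => μ.real {ω | ε ≤ |V i ω - W i ω|}) atTop (𝓝 0) := by
  intro ε hε
  refine tendsto_order.2 ⟨fun a ha => .of_forall fun i => ha.trans_le measureReal_nonneg,
    fun η hη => ?_⟩
  obtain ⟨M, hM⟩ := hW (η / 2) (half_pos hη)
  -- A grid of mesh `ε/4` covers `[-M, M]`; the `+ 3` in `K` leaves room for the neighbours `j + 2`
  -- and `j - 1` used below.
  set e := ε / 4 with he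
  have hepos : 0 < e := by positivity
  set K : ℤ := ⌈M / e⌉ + 3
  set T := Finset.Icc (-K) K
  have hsum : Tendsto (fun i => ∑ j ∈ T, μ.real {ω | e / 2 ≤ |Z (j * e) i ω - W i ω|}) atTop
      (𝓝 0) := by
    simpa using tendsto_finsetSum T fun j _ => hZ (j * e) (e / 2) (half_pos hepos)
  have h1 : ∀ᶠ i in atTop, ∀ j ∈ T, ∀ ω, V i ω ≤ j * e ↔ Z (j * e) i ω ≤ τ (j * e) i :=
    (Filter.eventually_all_finset T).2 fun j _ => hV _
  have h2 : ∀ᶠ i in atTop, ∀ j ∈ T, |τ (j * e) i - j * e| < e / 2 :=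
    (Filter.eventually_all_finset T).2 fun j _ =>
      (Metric.tendsto_nhds.1 (hτ (j * e))) (e / 2) (half_pos hepos)
  filter_upwards [hM, h1, h2, hsum.eventually_lt_const (half_pos hη)] with i hMi h1i h2i hsi
  have hsub : {ω | ε ≤ |V i ω - W i ω|} ⊆
      {ω | M ≤ |W i ω|} ∪ ⋃ j ∈ T, {ω | e / 2 ≤ |Z (j * e) i ω - W i ω|} := by
    intro ω hω
    by_contra hcon
    simp only [Set.mem_union, Set.mem_iUnion, Set.mem_ofPred_eq, not_or, not_exists, not_le] at hcon
    obtain ⟨hWM, hZW⟩ := hcon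
    obtain ⟨hWM1, hWM2⟩ := abs_lt.1 hWM
    set j := ⌊W i ω / e⌋
    have hj1 : (j : ℝ) * e ≤ W i ω := (le_div_iff₀ hepos).1 (Int.floor_le _)
    have hj2 : W i ω < (j + 1) * e := (div_lt_iff₀ hepos).1 (Int.lt_floor_add_one _)
    have hc : M / e ≤ ⌈M / e⌉ := Int.le_ceil _
    have hc' : M ≤ ⌈M / e⌉ * e := (div_le_iff₀ hepos).1 hc
    have hju : j ≤ ⌈M / e⌉ := by
      have : (j : ℝ) * e < (⌈M / e⌉ : ℝ) * e := by linarith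
      exact_mod_cast (lt_of_mul_lt_mul_right this hepos.le).le
    have hjl : -⌈M / e⌉ - 1 ≤ j := by
      have : (-(⌈M / e⌉ : ℝ)) * e < ((j : ℝ) + 1) * e := by linarith
      have h3 : -(⌈M / e⌉ : ℝ) < (j : ℝ) + 1 := lt_of_mul_lt_mul_right this hepos.le
      have h4 : -⌈M / e⌉ < j + 1 := by exact_mod_cast h3
      omega
    -- Here `j e ≤ W < (j + 1) e`. If `V ≥ W + 4e`, then `V > (j + 2) e` forces `Z > (j + 3/2) e`,
    -- against `Z < W + e/2`. The other side is symmetric, with the grid point `(j - 1) e`.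
    rcases le_abs.1 (show ε ≤ |V i ω - W i ω| from hω) with hVW | hVW
    · have hjT : j + 2 ∈ T := Finset.mem_Icc.2 ⟨by omega, by omega⟩
      have a1 := h1i _ hjT ω
      have a2 := abs_lt.1 (h2i _ hjT)
      have a3 := abs_lt.1 (hZW _ hjT)
      push_cast at a1 a2 a3
      have a4 : ¬ (V i ω ≤ ((j : ℝ) + 2) * e) := by linarith
      rw [a1, not_le] at a4
      linarith [a2.1, a3.2]
    · have hjT : j - 1 ∈ T := Finset.mem_Icc.2 ⟨by omega, by omega⟩
      have a1 := h1i _ hjT ω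
      have a2 := abs_lt.1 (h2i _ hjT)
      have a3 := abs_lt.1 (hZW _ hjT)
      push_cast at a1 a2 a3
      have a4 : V i ω ≤ ((j : ℝ) - 1) * e := by linarith
      rw [a1] at a4
      linarith [a2.2, a3.1]
  calc μ.real {ω | ε ≤ |V i ω - W i ω|}
      ≤ μ.real ({ω | M ≤ |W i ω|} ∪ ⋃ j ∈ T, {ω | e / 2 ≤ |Z (j * e) i ω - W i ω|}) :=
        measureReal_mono hsub
    _ ≤ μ.real {ω | M ≤ |W i ω|} + μ.real (⋃ j ∈ T, {ω | e / 2 ≤ |Z (j * e) i ω - W i ω|}) :=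
        measureReal_union_le _ _
    _ ≤ η / 2 + ∑ j ∈ T, μ.real {ω | e / 2 ≤ |Z (j * e) i ω - W i ω|} :=
        add_le_add hMi (measureReal_biUnion_finset_le _ _)
    _ < η := by linarith

lemma tendsto_sqrt_mul_sigmoid_sub {n : ℕ → ℕ} (hn : Tendsto n atTop atTop) (ξ t : ℝ) :
    Tendsto (fun i => √(n i : ℝ) * (Real.sigmoid (ξ + t / √(n i : ℝ)) - Real.sigmoid ξ)) atTop
      (𝓝 (Real.sigmoid ξ * (1 - Real.sigmoid ξ) * t)) := by
  have hd : HasDerivAt (fun x => Real.sigmoid (ξ + t * x))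
      (Real.sigmoid ξ * (1 - Real.sigmoid ξ) * t) 0 := by
    have h1 : HasDerivAt (fun x : ℝ => ξ + t * x) t 0 := by
      simpa using ((hasDerivAt_id (0 : ℝ)).const_mul t).const_add ξ
    have h2 : HasDerivAt Real.sigmoid (Real.sigmoid ξ * (1 - Real.sigmoid ξ)) (ξ + t * 0) := by
      simpa using Real.hasDerivAt_sigmoid ξ
    exact HasDerivAt.comp (h₂ := Real.sigmoid) 0 h2 h1
  have hs : Tendsto (fun i => √(n i : ℝ)) atTop atTop :=
    Real.tendsto_sqrt_atTop.comp (tendsto_natCast_atTop_atTop.comp hn)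
  have hinv : Tendsto (fun i => (√(n i : ℝ))⁻¹) atTop (𝓝[≠] 0) := by
    refine tendsto_nhdsWithin_iff.2 ⟨tendsto_inv_atTop_zero.comp hs, ?_⟩
    filter_upwards [hs.eventually_gt_atTop 0] with i hi
    exact (inv_pos.2 hi).ne'
  refine (hd.tendsto_slope_zero.comp hinv).congr fun i => ?_
  simp [div_eq_mul_inv]

namespace IsLogisticSample

variable {Ω : Type*} [MeasurableSpace Ω] {μ : Measure Ω} [IsProbabilityMeasure μ]
  {Y : ℕ → Ω → ℝ}

/-- The Bahadur representation of the sample quantiles of a logistic sample. -/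
lemma tendsto_bahadur (h : IsLogisticSample μ Y) {n k : ℕ → ℕ} {ξ : ℝ}
    (hn : Tendsto n atTop atTop) (hk : ∀ᶠ i in atTop, 1 ≤ k i ∧ k i ≤ n i)
    (hkn : Tendsto (fun i => √(n i : ℝ) * ((k i : ℝ) / n i - Real.sigmoid ξ)) atTop (𝓝 0)) :
    ∀ ε > 0, Tendsto (fun i => μ.real {ω | ε ≤
      |√(n i : ℝ) * (orderStat (fun j : Fin (n i) => Y j ω) (k i) - ξ) -
        √(n i : ℝ) * (Real.sigmoid ξ - countLE (fun j => Y j ω) (n i) ξ / n i) /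
          (Real.sigmoid ξ * (1 - Real.sigmoid ξ))|}) atTop (𝓝 0) := by
  set f := Real.sigmoid ξ * (1 - Real.sigmoid ξ) with hf
  have hfpos : 0 < f := mul_pos (Real.sigmoid_pos ξ) (sub_pos.2 (Real.sigmoid_lt_one ξ))
  have hnpos : ∀ᶠ i in atTop, (0 : ℝ) < n i := by
    filter_upwards [hn.eventually_ge_atTop 1] with i hi
    exact_mod_cast hi
  have hs : Tendsto (fun i => √(n i : ℝ)) atTop atTop :=
    Real.tendsto_sqrt_atTop.comp (tendsto_natCast_atTop_atTop.comp hn)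
  have hsq : ∀ i, √(n i : ℝ) ^ 2 = n i := fun i => Real.sq_sqrt (Nat.cast_nonneg _)
  -- `√n (Y_(k) - ξ) ≤ t` means that `k/n` is at most the empirical distribution function at `ξ +
  -- t/√n`. Subtracting both from `σ(ξ + t/√n)` and scaling by `√n / f` gives `Z ≤ τ`.
  refine tendstoInMeasure_sub_of_le_iff
    (Z := fun t i ω => √(n i : ℝ) * (Real.sigmoid (ξ + t / √(n i : ℝ)) -
      countLE (fun j => Y j ω) (n i) (ξ + t / √(n i : ℝ)) / n i) / f)
    (τ := fun t i => √(n i : ℝ) * (Real.sigmoid (ξ + t / √(n i : ℝ)) - (k i : ℝ) / n i) / f)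
    (fun t => ?_) (fun t δ hδ => ?_) (fun t => ?_) (fun η hη => ?_)
  · have := ((tendsto_sqrt_mul_sigmoid_sub hn ξ t).sub hkn).div_const f
    rw [sub_zero, ← hf, mul_div_cancel_left₀ _ hfpos.ne'] at this
    refine this.congr fun i => ?_
    ring
  -- The second moment of an increment over the shrinking interval between `ξ` and `ξ + t/√n` tends
  -- to `0`, and Chebyshev's bound with it.
  · have hlim : Tendsto (fun i => (Real.sigmoid (max ξ (ξ + t / √(n i : ℝ))) -
        Real.sigmoid (min ξ (ξ + t / √(n i : ℝ)))) / (δ * f) ^ 2) atTop (𝓝 0) := by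
      have h1 : Tendsto (fun i => ξ + t / √(n i : ℝ)) atTop (𝓝 ξ) := by
        simpa using (tendsto_const_nhds (x := t)).div_atTop hs |>.const_add ξ
      have h2 := (continuous_sigmoid.tendsto _).comp ((tendsto_const_nhds (x := ξ)).max h1)
      have h3 := (continuous_sigmoid.tendsto _).comp ((tendsto_const_nhds (x := ξ)).min h1)
      simpa using (h2.sub h3).div_const ((δ * f) ^ 2)
    refine tendsto_of_tendsto_of_tendsto_of_le_of_le' tendsto_const_nhds hlim
      (.of_forall fun i => measureReal_nonneg) ?_
    filter_upwards [hnpos] with i hi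
    set b := ξ + t / √(n i : ℝ)
    have hsi : 0 < √(n i : ℝ) := Real.sqrt_pos.2 hi
    have hm : ∫ ω, (indLE b (Y 0 ω) - indLE ξ (Y 0 ω)) ∂μ = Real.sigmoid b - Real.sigmoid ξ := by
      rw [integral_sub (h.integrable_indLE 0 b) (h.integrable_indLE 0 ξ), h.integral_indLE,
        h.integral_indLE]
    have hm2 : ∫ ω, (indLE b (Y 0 ω) - indLE ξ (Y 0 ω)) ^ 2 ∂μ =
        Real.sigmoid (max ξ b) - Real.sigmoid (min ξ b) := by
      simp only [indLE_sub_sq]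
      rw [integral_sub (h.integrable_indLE 0 _) (h.integrable_indLE 0 _), h.integral_indLE,
        h.integral_indLE]
    have hch := h.measureReal_abs_sum_sub_ge_le ((measurable_indLE b).sub (measurable_indLE ξ))
      (fun y => abs_indLE_sub_le ξ b y) (n i) (c := δ * f * √(n i : ℝ)) (by positivity)
    simp only [Pi.sub_apply] at hch
    rw [hm, hm2] at hch
    convert! hch using 1
    · congr 1
      ext ω
      simp only [Set.mem_ofPred_eq]
      have : √(n i : ℝ) * (Real.sigmoid b - countLE (fun j => Y j ω) (n i) b / n i) / f -
          √(n i : ℝ) * (Real.sigmoid ξ - countLE (fun j => Y j ω) (n i) ξ / n i) / f =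
          -((∑ j ∈ Finset.range (n i), (indLE b (Y j ω) - indLE ξ (Y j ω)) -
            n i * (Real.sigmoid b - Real.sigmoid ξ)) / (f * √(n i : ℝ))) := by
        rw [Finset.sum_sub_distrib, ← countLE_eq_sum_indLE (fun j => Y j ω),
          ← countLE_eq_sum_indLE (fun j => Y j ω), ← hsq i]
        field_simp
        rw [Real.sqrt_sq hsi.le]
        ring
      rw [this, abs_neg, abs_div, abs_of_pos (mul_pos hfpos hsi), le_div_iff₀ (mul_pos hfpos hsi),
        ← mul_assoc]
    · rw [mul_pow _ (√(n i : ℝ)), hsq]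
      field_simp
  · filter_upwards [hk, hnpos] with i hi hni ω
    have hsi : 0 < √(n i : ℝ) := Real.sqrt_pos.2 hni
    rw [div_le_div_iff_of_pos_right hfpos, mul_le_mul_iff_right₀ hsi, sub_le_sub_iff_left,
      div_le_div_iff_of_pos_right hni, Nat.cast_le, ← orderStat_le_iff (fun j => Y j ω) hi.1 hi.2,
      ← le_div_iff₀' hsi, sub_le_iff_le_add']
  -- Tightness: this threshold makes Chebyshev's bound, with second moment at most `1`, equal to
  -- `η`.
  · refine ⟨√(η⁻¹) / f, ?_⟩
    filter_upwards [hnpos] with i hni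
    have hsi : 0 < √(n i : ℝ) := Real.sqrt_pos.2 hni
    have hη' : 0 < √(η⁻¹) := Real.sqrt_pos.2 (inv_pos.2 hη)
    have hch := h.measureReal_abs_sum_sub_ge_le (measurable_indLE ξ) (abs_indLE_le ξ) (n i)
      (c := √(η⁻¹) * √(n i : ℝ)) (by positivity)
    rw [h.integral_indLE] at hch
    have hm2 : ∫ ω, indLE ξ (Y 0 ω) ^ 2 ∂μ ≤ 1 := by
      have : ∀ ω, indLE ξ (Y 0 ω) ^ 2 = indLE ξ (Y 0 ω) := by
        intro ω; unfold indLE; split_ifs <;> norm_num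
      simp only [this]
      rw [h.integral_indLE]
      exact Real.sigmoid_le_one ξ
    have hset : {ω | √(η⁻¹) / f ≤ |√(n i : ℝ) * (Real.sigmoid ξ -
        countLE (fun j => Y j ω) (n i) ξ / n i) / f|} =
        {ω | √(η⁻¹) * √(n i : ℝ) ≤ |∑ j ∈ Finset.range (n i), indLE ξ (Y j ω) -
          n i * Real.sigmoid ξ|} := by
      ext ω
      simp only [Set.mem_ofPred_eq]
      have : √(n i : ℝ) * (Real.sigmoid ξ - countLE (fun j => Y j ω) (n i) ξ / n i) / f =
          -((∑ j ∈ Finset.range (n i), indLE ξ (Y j ω) - n i * Real.sigmoid ξ) /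
            (√(n i : ℝ) * f)) := by
        rw [← countLE_eq_sum_indLE (fun j => Y j ω), ← hsq i]
        field_simp
        rw [Real.sqrt_sq hsi.le]
        ring
      rw [this, abs_neg, abs_div, abs_of_pos (mul_pos hsi hfpos),
        div_le_div_iff₀ hfpos (mul_pos hsi hfpos), ← mul_assoc, mul_le_mul_iff_left₀ hfpos]
    rw [hset]
    refine hch.trans ?_
    rw [mul_pow, hsq, Real.sq_sqrt (inv_pos.2 hη).le, div_le_iff₀ (by positivity)]
    calc (n i : ℝ) * ∫ ω, indLE ξ (Y 0 ω) ^ 2 ∂μ ≤ n i * 1 := by gcongr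
      _ = η * (η⁻¹ * n i) := by field_simp

end IsLogisticSample

/-! ### Sample sizes, plotting positions and Gaussian scaling -/

lemma Real.sigmoid_log {c : ℝ} (hc : 0 < c) : Real.sigmoid (Real.log c) = c / (c + 1) := by
  rw [Real.sigmoid_def, Real.exp_neg, Real.exp_log hc]
  field_simp

lemma sampleSize_add_one {i : ℕ} (hi : 1 ≤ i) (s : ℕ) : sampleSize i s + 1 = i * (s + 1) :=
  Nat.sub_add_cancel (Nat.mul_pos hi (Nat.succ_pos s))

lemma mul_le_sampleSize {i : ℕ} (hi : 1 ≤ i) (s : ℕ) : i * s ≤ sampleSize i s := by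
  have h1 := sampleSize_add_one hi s
  have h2 : i * (s + 1) = i * s + i := by ring
  omega

lemma cast_sampleSize {i : ℕ} (hi : 1 ≤ i) (s : ℕ) : (sampleSize i s : ℝ) = i * (s + 1) - 1 := by
  rw [eq_sub_iff_add_eq]
  exact_mod_cast sampleSize_add_one hi s

/-- This survives `i = 0`: the truncated subtraction gives `0`, and so does the real square root of
`-1`. -/
lemma sqrt_cast_sampleSize (i s : ℕ) : √((i : ℝ) * (s + 1) - 1) = √(sampleSize i s : ℝ) := by
  rcases Nat.eq_zero_or_pos i with rfl | hi
  · rw [Real.sqrt_eq_zero_of_nonpos (by simp)]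
    simp
  · rw [cast_sampleSize hi]

lemma tendsto_sampleSize (s : ℕ) (hs : 1 ≤ s) :
    Tendsto (fun i => sampleSize i s) atTop atTop := by
  refine tendsto_atTop_mono' _ ?_ tendsto_id
  filter_upwards [eventually_ge_atTop 1] with i hi
  exact (Nat.le_mul_of_pos_right i hs).trans (mul_le_sampleSize hi s)

/-- If `k (s + 1) = p (n + 1)` then the plotting position `k / n` is within `O(1 / n)` of
`p / (s + 1)`. -/
lemma tendsto_sqrt_mul_div_sampleSize_sub {s : ℕ} (hs : 1 ≤ s) (p : ℕ) :
    Tendsto (fun i : ℕ => √(sampleSize i s : ℝ) *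
      (((i * p : ℕ) : ℝ) / sampleSize i s - (p : ℝ) / (s + 1))) atTop (𝓝 0) := by
  have hn := Real.tendsto_sqrt_atTop.comp
    (tendsto_natCast_atTop_atTop.comp (tendsto_sampleSize s hs))
  -- Since `i (s + 1) = n + 1`, the deviation is exactly `p / ((s + 1) n)`.
  refine ((tendsto_const_nhds (x := (p : ℝ) / (s + 1))).div_atTop hn).congr' ?_
  filter_upwards [eventually_ge_atTop 1, (tendsto_sampleSize s hs).eventually_ge_atTop 1]
    with i hi hni
  have hpos : (0 : ℝ) < sampleSize i s := by exact_mod_cast hni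
  have hsq : √(sampleSize i s : ℝ) ^ 2 = sampleSize i s := Real.sq_sqrt hpos.le
  have hsi := Real.sqrt_pos.2 hpos
  have hc := cast_sampleSize hi s
  have hi' : (i : ℝ) * (s + 1) = √(sampleSize i s : ℝ) ^ 2 + 1 := by rw [hsq, hc]; ring
  simp only [Function.comp]
  generalize √(sampleSize i s : ℝ) = q at *
  rw [← hsq]
  push_cast
  field_simp
  linear_combination (-(p : ℝ)) * hi'

lemma tendsto_div_sampleSize {s : ℕ} (hs : 1 ≤ s) (p : ℕ) :
    Tendsto (fun i : ℕ => ((i * p : ℕ) : ℝ) / sampleSize i s) atTop (𝓝 ((p : ℝ) / (s + 1))) := by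
  have hn := Real.tendsto_sqrt_atTop.comp
    (tendsto_natCast_atTop_atTop.comp (tendsto_sampleSize s hs))
  have h := ((tendsto_sqrt_mul_div_sampleSize_sub hs p).div_atTop hn).add_const ((p : ℝ) / (s + 1))
  rw [zero_add] at h
  refine h.congr' ?_
  filter_upwards [hn.eventually_gt_atTop 0] with i hi
  simp only [Function.comp] at hi ⊢
  rw [mul_div_cancel_left₀ _ hi.ne', sub_add_cancel]

lemma eventually_rank_mem {s : ℕ} {p : ℕ} (hp : 1 ≤ p) (hps : p ≤ s) :
    ∀ᶠ i in atTop, 1 ≤ i * p ∧ i * p ≤ sampleSize i s := by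
  filter_upwards [eventually_ge_atTop 1] with i hi
  exact ⟨Nat.mul_pos hi hp, (Nat.mul_le_mul_left i hps).trans (mul_le_sampleSize hi s)⟩

lemma tendstoInDistribution_const_mul_gaussianReal {Ω : Type*} [MeasurableSpace Ω] {μ : Measure Ω}
    [IsProbabilityMeasure μ] {T : ℕ → Ω → ℝ} {v w : ℝ} (c : ℝ) (hw : w = c ^ 2 * v)
    (h : TendstoInDistribution T atTop (id : ℝ → ℝ) (fun _ => μ) (gaussianReal 0 v.toNNReal)) :
    TendstoInDistribution (fun i ω => c * T i ω) atTop (id : ℝ → ℝ) (fun _ => μ)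
      (gaussianReal 0 w.toNNReal) := by
  have h1 := h.continuous_comp (g := fun x => c * x) (by fun_prop)
  refine ⟨h1.forall_aemeasurable, aemeasurable_id, ?_⟩
  convert! h1.tendsto using 2
  refine congrArg 𝓝 (Subtype.ext ?_)
  change (gaussianReal 0 w.toNNReal).map id =
    (gaussianReal 0 v.toNNReal).map ((fun x => c * x) ∘ id)
  rw [Measure.map_id, Function.comp_id, gaussianReal_map_const_mul, mul_zero, hw,
    Real.toNNReal_mul (sq_nonneg c)]
  congr
  ext
  simp [sq_nonneg]

/-! ### Limit theorems for the logistic spacing -/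

namespace IsLogisticSample

variable {Ω : Type*} [MeasurableSpace Ω] {μ : Measure Ω} [IsProbabilityMeasure μ]
  {Y : ℕ → Ω → ℝ}

lemma ae_tendsto_orderStat_sub (h : IsLogisticSample μ Y) {s : ℕ} (hs : 2 ≤ s) :
    ∀ᵐ ω ∂μ, Tendsto (fun i => orderStat (fun j : Fin (sampleSize i s) => Y j ω) (i * s) -
      orderStat (fun j : Fin (sampleSize i s) => Y j ω) i) atTop (𝓝 (2 * Real.log s)) := by
  have hs0 : (0 : ℝ) < s := by positivity
  have hq := h.ae_tendsto_orderStat (ξ := Real.log s) (tendsto_sampleSize s (by omega))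
    (eventually_rank_mem (by omega) le_rfl)
    (by rw [Real.sigmoid_log hs0]; exact tendsto_div_sampleSize (by omega) s)
  have hp := h.ae_tendsto_orderStat (ξ := -Real.log s) (tendsto_sampleSize s (by omega))
    (eventually_rank_mem (p := 1) le_rfl (by omega))
    (by
      rw [Real.sigmoid_neg, Real.sigmoid_log hs0]
      convert! tendsto_div_sampleSize (show 1 ≤ s by omega) 1 using 2
      push_cast
      field_simp
      ring)
  filter_upwards [hq, hp] with ω h1 h2
  convert! h1.sub h2 using 2
  · simp
  · ring

lemma tendstoInDistribution_orderStat_sub (h : IsLogisticSample μ Y) {s : ℕ} (hs : 2 ≤ s) :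
    TendstoInDistribution (fun i ω => √(sampleSize i s : ℝ) *
        (orderStat (fun j : Fin (sampleSize i s) => Y j ω) (i * s) -
          orderStat (fun j : Fin (sampleSize i s) => Y j ω) i - 2 * Real.log s))
      atTop (id : ℝ → ℝ) (fun _ => μ)
      (gaussianReal 0 (Real.toNNReal (2 * ((s : ℝ) + 1) ^ 2 * ((s : ℝ) - 1) / (s : ℝ) ^ 2))) := by
  have hs0 : (0 : ℝ) < s := by positivity
  have hs2 : (2 : ℝ) ≤ s := by exact_mod_cast hs
  have hlog : 0 ≤ Real.log s := Real.log_nonneg (by linarith)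
  have hσq : Real.sigmoid (Real.log s) = s / (s + 1) := Real.sigmoid_log hs0
  have hσp : Real.sigmoid (-Real.log s) = 1 / (s + 1) := by
    rw [Real.sigmoid_neg, hσq]
    field_simp
    ring
  set f : ℝ := s / (s + 1) ^ 2 with hf
  have hf0 : 0 < f := by positivity
  have hfq : Real.sigmoid (Real.log s) * (1 - Real.sigmoid (Real.log s)) = f := by
    rw [hσq, hf]; field_simp; ring
  have hfp : Real.sigmoid (-Real.log s) * (1 - Real.sigmoid (-Real.log s)) = f := by
    rw [hσp, hf]; field_simp; ring
  -- The difference of the two Bahadur linear terms is a normalised sum of centred copies of `-g(Y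
  -- j)`.
  set g : ℝ → ℝ := fun y => f⁻¹ * (indLE (Real.log s) y - indLE (-Real.log s) y) with hg
  have hgm : Measurable g := ((measurable_indLE _).sub (measurable_indLE _)).const_mul _
  have hgb : ∀ y, |g y| ≤ f⁻¹ := by
    intro y
    rw [hg, abs_mul, abs_of_pos (inv_pos.2 hf0)]
    exact mul_le_of_le_one_right (inv_pos.2 hf0).le (abs_indLE_sub_le _ _ y)
  have hmean : ∫ ω, g (Y 0 ω) ∂μ = f⁻¹ * (s / (s + 1) - 1 / (s + 1)) := by
    rw [hg, integral_const_mul, integral_sub (h.integrable_indLE 0 _) (h.integrable_indLE 0 _),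
      h.integral_indLE, h.integral_indLE, hσq, hσp]
  have hL : MemLp (fun ω => g (Y 0 ω)) 2 μ := h.memLp_comp hgm hgb 0 2
  -- `g` is `f⁻¹` times a Bernoulli variable of parameter `(s-1)/(s+1)`, whose variance is
  -- `2(s-1)/(s+1)²`.
  have hvar : Var[fun ω => g (Y 0 ω); μ] = 2 * ((s : ℝ) + 1) ^ 2 * ((s : ℝ) - 1) / (s : ℝ) ^ 2 := by
    rw [variance_eq_sub hL, hmean]
    simp only [Pi.pow_apply, hg, mul_pow, indLE_sub_sq]
    rw [integral_const_mul, integral_sub (h.integrable_indLE 0 _) (h.integrable_indLE 0 _),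
      h.integral_indLE, h.integral_indLE, max_eq_right (by linarith), min_eq_left (by linarith),
      hσq, hσp, hf]
    field_simp
    ring
  have hclt := tendstoInDistribution_inv_sqrt_mul_sum_sub (P := μ) (X := fun j ω => -g (Y j ω))
    (Y := (id : ℝ → ℝ))
    (P' := gaussianReal 0 (Real.toNNReal (2 * ((s : ℝ) + 1) ^ 2 * ((s : ℝ) - 1) / (s : ℝ) ^ 2)))
    ⟨aemeasurable_id, by rw [variance_fun_neg, hvar, Measure.map_id]⟩ hL.neg
    (h.indep.comp (fun _ y => -g y) fun _ => hgm.neg)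
    (fun j => (h.identDistrib j).comp hgm.neg)
  have hns := tendsto_sampleSize s (by omega)
  have hclt' : TendstoInDistribution (fun i ω => (√(sampleSize i s : ℝ))⁻¹ *
      (∑ j ∈ Finset.range (sampleSize i s), -g (Y j ω) -
        sampleSize i s * ∫ ω, -g (Y 0 ω) ∂μ)) atTop (id : ℝ → ℝ) (fun _ => μ)
      (gaussianReal 0 (Real.toNNReal (2 * ((s : ℝ) + 1) ^ 2 * ((s : ℝ) - 1) / (s : ℝ) ^ 2))) :=
    ⟨fun i => hclt.forall_aemeasurable _, aemeasurable_id, hclt.tendsto.comp hns⟩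
  -- Slutsky: the two Bahadur remainders, each below `ε/2` outside a small event, do not affect the
  -- limit law.
  refine tendstoInDistribution_of_tendstoInMeasure_sub _ _ hclt' ?_ fun i => ?_
  · have hq := h.tendsto_bahadur (ξ := Real.log s) hns (eventually_rank_mem (by omega) le_rfl)
      (by rw [hσq]; exact tendsto_sqrt_mul_div_sampleSize_sub (by omega) s)
    have hp := h.tendsto_bahadur (ξ := -Real.log s) hns
      (eventually_rank_mem (p := 1) le_rfl (by omega))
      (by
        rw [hσp]
        convert! tendsto_sqrt_mul_div_sampleSize_sub (show 1 ≤ s by omega) 1 using 5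
        simp)
    rw [hfq, hσq] at hq
    rw [hfp, hσp] at hp
    rw [tendstoInMeasure_iff_measureReal_norm]
    intro ε hε
    have hsum := (hq (ε / 2) (half_pos hε)).add (hp (ε / 2) (half_pos hε))
    rw [add_zero] at hsum
    refine tendsto_of_tendsto_of_tendsto_of_le_of_le' tendsto_const_nhds hsum
      (.of_forall fun i => measureReal_nonneg) ?_
    filter_upwards [hns.eventually_ge_atTop 1] with i hi
    refine (measureReal_mono ?_).trans (measureReal_union_le _ _)
    intro ω hω
    simp only [Set.mem_ofPred_eq, Pi.sub_apply, Pi.zero_apply, sub_zero, Real.norm_eq_abs] at hω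
    rw [Set.mem_union]
    by_contra hcon
    simp only [Set.mem_ofPred_eq, not_or, not_le, mul_one] at hcon
    refine absurd hω (not_le.2 ?_)
    have hpos : (0 : ℝ) < sampleSize i s := by exact_mod_cast hi
    have hsi := Real.sqrt_pos.2 hpos
    have hsq : √(sampleSize i s : ℝ) ^ 2 = sampleSize i s := Real.sq_sqrt hpos.le
    have key := (abs_sub _ _).trans_lt (add_lt_add hcon.1 hcon.2)
    rw [add_halves] at key
    refine lt_of_eq_of_lt (congrArg _ ?_) key
    rw [integral_neg, hmean, Finset.sum_neg_distrib, hg, ← Finset.mul_sum, Finset.sum_sub_distrib,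
      ← countLE_eq_sum_indLE (fun j => Y j ω), ← countLE_eq_sum_indLE (fun j => Y j ω)]
    generalize √(sampleSize i s : ℝ) = q at *
    rw [← hsq]
    field_simp
    ring
  · exact ((((measurable_orderStat h.measurable _ _).sub
      (measurable_orderStat h.measurable _ _)).sub_const _).const_mul _).aemeasurable

end IsLogisticSample

/-! ### Transfer from the logistic to the Log-Logistic sample -/

section LogLogistic

variable {Ω : Type*} [MeasurableSpace Ω] {μ : Measure Ω} [IsProbabilityMeasure μ] {α : ℝ}
  {X : ℕ → Ω → ℝ}

omit [IsProbabilityMeasure μ] in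
lemma measureReal_le_of_isLogLogistic (hX : ∀ j, Measurable (X j))
    (hlaw : ∀ j, IsLogLogistic α (μ.map (X j))) (j : ℕ) (x : ℝ) :
    μ.real {ω | X j ω ≤ x} = logLogisticCDF α x := by
  have := (hlaw j).1
  rw [← (hlaw j).2 x, cdf_eq_real, map_measureReal_apply (hX j) measurableSet_Iic]
  rfl

lemma ae_pos_of_isLogLogistic (hX : ∀ j, Measurable (X j))
    (hlaw : ∀ j, IsLogLogistic α (μ.map (X j))) : ∀ᵐ ω ∂μ, ∀ j, 0 < X j ω := by
  refine ae_all_iff.2 fun j => ?_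
  have h := measureReal_le_of_isLogLogistic hX hlaw j 0
  rw [logLogisticCDF, if_neg (lt_irrefl 0), measureReal_eq_zero_iff] at h
  rw [ae_iff]
  simpa only [not_lt] using h

lemma isLogisticSample_mul_log (hα : 0 < α) (hX : ∀ j, Measurable (X j)) (hindep : iIndepFun X μ)
    (hlaw : ∀ j, IsLogLogistic α (μ.map (X j))) :
    IsLogisticSample μ (fun j ω => α * Real.log (X j ω)) where
  measurable j := (Real.measurable_log.comp (hX j)).const_mul α
  indep := hindep.comp (fun _ x => α * Real.log x) fun _ => Real.measurable_log.const_mul α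
  law j t := by
    -- The events agree only almost surely: `Real.log` takes conventional values at nonpositive
    -- arguments.
    have hset : {ω | α * Real.log (X j ω) ≤ t} =ᵐ[μ] {ω | X j ω ≤ Real.exp (t / α)} := by
      filter_upwards [ae_pos_of_isLogLogistic hX hlaw] with ω hω
      refine propext ?_
      change α * Real.log (X j ω) ≤ t ↔ X j ω ≤ Real.exp (t / α)
      rw [← Real.log_le_iff_le_exp (hω j), le_div_iff₀ hα, mul_comm]
    rw [measureReal_congr hset, measureReal_le_of_isLogLogistic hX hlaw, logLogisticCDF,
      if_pos (Real.exp_pos _), ← Real.exp_mul, Real.sigmoid_def, one_div]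
    congr 3
    field_simp

lemma mul_logRatio (hα : 0 < α) {x : ℕ → ℝ} (hx : ∀ j, 0 < x j) {i s : ℕ} (hi : 1 ≤ i)
    (hs : 1 ≤ s) :
    α * logRatio i s (fun j => x j) =
      orderStat (fun j : Fin (sampleSize i s) => α * Real.log (x j)) (i * s) -
        orderStat (fun j : Fin (sampleSize i s) => α * Real.log (x j)) i := by
  have h1 : 1 ≤ i * s := Nat.mul_pos hi hs
  have h2 := mul_le_sampleSize hi s
  have h3 : i ≤ sampleSize i s := (Nat.le_mul_of_pos_right i hs).trans h2
  rw [logRatio, Real.log_div (orderStat_pos hx h1 h2).ne' (orderStat_pos hx hi h3).ne', mul_sub,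
    mul_log_orderStat hα hx h1 h2, mul_log_orderStat hα hx hi h3]

lemma integrable_logRatio_and_integral (hα : 0 < α) (hX : ∀ j, Measurable (X j))
    (hindep : iIndepFun X μ) (hlaw : ∀ j, IsLogLogistic α (μ.map (X j))) {i s : ℕ} (hi : 1 ≤ i)
    (hs : 1 ≤ s) :
    Integrable (fun ω => logRatio i s (fun j => X j ω)) μ ∧
      ∫ ω, logRatio i s (fun j => X j ω) ∂μ = 2 * harmonicDiff i s / α := by
  have h := isLogisticSample_mul_log hα hX hindep hlaw
  have his : i ≤ i * s := Nat.le_mul_of_pos_right i hs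
  have hae : (fun ω => α⁻¹ *
      (orderStat (fun j : Fin (sampleSize i s) => α * Real.log (X j ω)) (i * s) -
        orderStat (fun j : Fin (sampleSize i s) => α * Real.log (X j ω)) i)) =ᵐ[μ]
      fun ω => logRatio i s (fun j => X j ω) := by
    filter_upwards [ae_pos_of_isLogLogistic hX hlaw] with ω hω
    rw [← mul_logRatio hα hω hi hs, inv_mul_cancel_left₀ hα.ne']
  refine ⟨((h.integrable_orderStat_sub hi his (mul_le_sampleSize hi s)).const_mul _).congr hae, ?_⟩
  rw [← integral_congr_ae hae, integral_const_mul,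
    h.integral_orderStat_sub hi his (mul_le_sampleSize hi s),
    sum_inv_add_inv_eq_harmonicDiff hi hs, inv_mul_eq_div]

lemma ae_tendsto_logRatio (hα : 0 < α) (hX : ∀ j, Measurable (X j))
    (hindep : iIndepFun X μ) (hlaw : ∀ j, IsLogLogistic α (μ.map (X j))) {s : ℕ} (hs : 2 ≤ s) :
    ∀ᵐ ω ∂μ, Tendsto (fun i => logRatio i s (fun j => X j ω)) atTop
      (𝓝 (2 * Real.log s / α)) := by
  filter_upwards [(isLogisticSample_mul_log hα hX hindep hlaw).ae_tendsto_orderStat_sub hs,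
    ae_pos_of_isLogLogistic hX hlaw] with ω h hω
  refine (h.div_const α).congr' ?_
  filter_upwards [eventually_ge_atTop 1] with i hi
  rw [← mul_logRatio hα hω hi (by omega), mul_div_cancel_left₀ _ hα.ne']

lemma tendstoInDistribution_logRatio (hα : 0 < α) (hX : ∀ j, Measurable (X j))
    (hindep : iIndepFun X μ) (hlaw : ∀ j, IsLogLogistic α (μ.map (X j))) {s : ℕ} (hs : 2 ≤ s) :
    TendstoInDistribution (fun (i : ℕ) ω => √((i : ℝ) * (s + 1) - 1) *
        (α * logRatio i s (fun j => X j ω) - 2 * Real.log s))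
      atTop (id : ℝ → ℝ) (fun _ => μ)
      (gaussianReal 0 (Real.toNNReal (2 * ((s : ℝ) + 1) ^ 2 * ((s : ℝ) - 1) / (s : ℝ) ^ 2))) := by
  refine TendstoInDistribution.congr (fun i => ?_) Filter.EventuallyEq.rfl
    ((isLogisticSample_mul_log hα hX hindep hlaw).tendstoInDistribution_orderStat_sub hs)
  filter_upwards [ae_pos_of_isLogLogistic hX hlaw] with ω hω
  rw [sqrt_cast_sampleSize]
  -- At `i = 0` both sequences vanish, because the factor `√n` is `0`.
  rcases Nat.eq_zero_or_pos i with rfl | hi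
  · simp
  · rw [mul_logRatio hα hω hi (by omega)]

end LogLogistic

theorem theorem2 {Ω : Type*} [MeasurableSpace Ω] (μ : Measure Ω) [IsProbabilityMeasure μ]
    (α : ℝ) (hα : 0 < α) (s : ℕ) (hs : 2 ≤ s)
    (X : ℕ → Ω → ℝ) (hX : ∀ j, Measurable (X j)) (hindep : iIndepFun X μ)
    (hlaw : ∀ j, IsLogLogistic α (μ.map (X j))) :
    -- i) unbiasedness
    (∀ i : ℕ, 1 ≤ i →
      Integrable (fun ω => estQLL i s (fun j => X j ω)) μ ∧
      ∫ ω, estQLL i s (fun j => X j ω) ∂μ = 1 / α) ∧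
    -- ii) strong consistency
    (∀ᵐ ω ∂μ, Tendsto (fun i : ℕ => estQLL i s (fun j => X j ω)) atTop (𝓝 (1 / α))) ∧
    -- iii) mean and asymptotic unbiasedness
    (∀ i : ℕ, 1 ≤ i →
      Integrable (fun ω => estQLLStar i s (fun j => X j ω)) μ ∧
      ∫ ω, estQLLStar i s (fun j => X j ω) ∂μ = harmonicDiff i s / (α * Real.log s)) ∧
    Tendsto (fun i : ℕ => harmonicDiff i s / (α * Real.log s)) atTop (𝓝 (1 / α)) ∧
    -- iv) strong consistency
    (∀ᵐ ω ∂μ, Tendsto (fun i : ℕ => estQLLStar i s (fun j => X j ω)) atTop (𝓝 (1 / α))) ∧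
    -- v) asymptotic normality
    TendstoInDistribution
      (fun (i : ℕ) ω => 2 * √((i : ℝ) * (s + 1) - 1) * harmonicDiff i s *
        (α * estQLL i s (fun j => X j ω) - Real.log s / harmonicDiff i s))
      atTop (id : ℝ → ℝ) (fun _ => μ)
      (gaussianReal 0 (Real.toNNReal (2 * ((s : ℝ) + 1) ^ 2 * ((s : ℝ) - 1) / (s : ℝ) ^ 2))) ∧
    -- vi) asymptotic normality
    TendstoInDistribution
      (fun (i : ℕ) ω => √((i : ℝ) * (s + 1) - 1) *
        (α * estQLLStar i s (fun j => X j ω) - 1))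
      atTop (id : ℝ → ℝ) (fun _ => μ)
      (gaussianReal 0 (Real.toNNReal
        (((s : ℝ) + 1) ^ 2 * ((s : ℝ) - 1) / (2 * (s : ℝ) ^ 2 * Real.log s ^ 2)))) := by
  have hlogs : 0 < Real.log s := Real.log_pos (by exact_mod_cast (by omega : 1 < s))
  have hharm := tendsto_harmonicDiff hs
  have hmean := fun (i : ℕ) (hi : 1 ≤ i) =>
    integrable_logRatio_and_integral hα hX hindep hlaw hi (show 1 ≤ s by omega)
  have hcons := ae_tendsto_logRatio hα hX hindep hlaw hs
  have hclt := tendstoInDistribution_logRatio hα hX hindep hlaw hs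
  refine ⟨fun i hi => ⟨((hmean i hi).1.div_const _).div_const 2, ?_⟩, ?_,
    fun i hi => ⟨((hmean i hi).1.div_const _).div_const 2, ?_⟩, ?_, ?_, ?_, ?_⟩
  · have := harmonicDiff_pos hi hs
    simp only [estQLL, estQ]
    rw [integral_div, integral_div, (hmean i hi).2]
    field_simp
  · filter_upwards [hcons] with ω hω
    convert! (hω.div hharm hlogs.ne').div_const 2 using 2
    field_simp
  · simp only [estQLLStar, estQStar]
    rw [integral_div, integral_div, (hmean i hi).2]
    field_simp
  · convert! hharm.div_const (α * Real.log s) using 2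
    field_simp
  · filter_upwards [hcons] with ω hω
    convert! (hω.div_const (Real.log s)).div_const 2 using 2
    field_simp
  -- The harmonic factor cancels exactly, so the statistic is the one in `hclt`, centred at `2 log
  -- s`.
  · convert! hclt using 3 with i ω
    rcases Nat.eq_zero_or_pos i with rfl | hi
    · rw [Real.sqrt_eq_zero_of_nonpos (by simp)]
      simp
    · have := harmonicDiff_pos hi hs
      simp only [estQLL, estQ]
      field_simp
  · convert! tendstoInDistribution_const_mul_gaussianReal (2 * Real.log s)⁻¹ ?_ hclt using 3 with i ω
    · simp only [estQLLStar, estQStar]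
      field_simp
    · field_simp
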